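/- Consider $N$ qubits and a parametrized quantum circuit $\mathbf U(\theta)=B_M(\theta)\cdots B_2(\theta)B_1(\theta)$ composed of $M$ blocks, where $B_k(\theta)$ is a unitary acting on the set of qubits $s(B_k)$ (and as the identity on the others), and the parameter $\theta$ is drawn from a probability distribution on the parameter space. Assume that the blocks are independent and that each $B_k$ is a unitary $2$-design on its support, that is, all moments of degree two in the entries of $B_k$ and degree two in their complex conjugates agree with those of the Haar measure on $\mathrm U(2^{|s(B_k)|})$. Let $H=\sum_j\lambda_j h_j$ with finitely many distinct $N$-qubit Pauli strings $h_j$ and real coefficients $\lambda_j$; assume that $H$ is traceless and that every qubit in the support of a Pauli string $h_j$ with $\lambda_j\neq0$ is acted on by at least one block. Let $C(\theta)=\langle \mathbf 0|\mathbf U^\dagger(\theta)H\mathbf U(\theta)|\mathbf 0\rangle$ with $|\mathbf 0\rangle=|0\rangle^{\otimes N}$. Let $r$ be the maximum of $|s(h_j)|$ over the $j$ with $\lambda_j\ne 0$, where $s(h_j)$ is the set of qubits on which $h_j$ is not the identity; let $\chi$ be the maximum local depth of the circuit, i.e. the maximum over all qubits of the number of blocks acting on the qubit; and let $\beta=\max_k|s(B_k)|$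 be the maximum block size. Then \[ \operatorname{Var}[C]\ \ge\ 4^{-r\chi\beta}\,\|\lambda\|_2^2 , \] and equivalently, if $\lambda\ne0$, the landscape fluctuation $\sigma=\sqrt{\operatorname{Var}[C]}/\|\lambda\|_1$ satisfies \[ \sigma\ \ge\ 2^{-r\chi\beta}\,\frac{\|\lambda\|_2}{\|\lambda\|_1}. \] -/

import Mathlib

open MeasureTheory ProbabilityTheory
open scoped Matrix

noncomputable section

namespace PQC

/-! ### Haar measure on the unitary group and unitary 2-designs -/

section Haar

variable (n : Type*) [Fintype n] [DecidableEq n]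

instance instMeasurableSpaceUnitaryGroup : MeasurableSpace (Matrix.unitaryGroup n ℂ) :=
  borel _

instance instBorelSpaceUnitaryGroup : BorelSpace (Matrix.unitaryGroup n ℂ) := ⟨rfl⟩

instance instCompactSpaceUnitaryGroup : CompactSpace (Matrix.unitaryGroup n ℂ) := by
  apply isCompact_iff_compactSpace.mp
  have hK : IsCompact (Set.pi Set.univ
      (fun _ : n => Set.pi Set.univ (fun _ : n => Metric.closedBall (0 : ℂ) 1))) :=
    isCompact_univ_pi fun _ => isCompact_univ_pi fun _ => isCompact_closedBall _ _
  have hclosed : IsClosed {A : Matrix n n ℂ | A ∈ Matrix.unitaryGroup n ℂ} := by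
    have : {A : Matrix n n ℂ | A ∈ Matrix.unitaryGroup n ℂ} = {A | A * star A = 1} := by
      ext A
      exact Matrix.mem_unitaryGroup_iff
    rw [this]
    exact isClosed_eq (by fun_prop) continuous_const
  refine IsCompact.of_isClosed_subset hK hclosed ?_
  intro A hA i _ j _
  rw [mem_closedBall_zero_iff]
  exact entry_norm_bound_of_unitary hA i j

/-- The Haar probability measure on the unitary group `U(n)`. -/
def haarUnitary : Measure (Matrix.unitaryGroup n ℂ) :=
  Measure.haarMeasure ⊤

variable {n}

/-- A random unitary `U : Θ → U(n)`, with parameters distributed according to `μ`, is a unitary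
2-design: every moment of degree two in the entries of `U` and degree two in the entries of its
complex conjugate equals the corresponding moment of the Haar measure. -/
def IsTwoDesign {Θ : Type*} [MeasurableSpace Θ] (μ : Measure Θ)
    (U : Θ → Matrix.unitaryGroup n ℂ) : Prop :=
  ∀ a b c d a' b' c' d' : n,
    ∫ θ, (U θ).1 a b * (U θ).1 c d * star ((U θ).1 a' b') * star ((U θ).1 c' d') ∂μ
      = ∫ V, V.1 a b * V.1 c d * star (V.1 a' b') * star (V.1 c' d') ∂(haarUnitary n)

end Haar

/-! ### Pauli strings and Hamiltonians on `N` qubits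

The computational basis of `N` qubits is indexed by `Fin N → Fin 2`. -/

/-- Labels of the single-qubit Pauli operators. -/
inductive Pauli : Type
  | I
  | X
  | Y
  | Z

/-- The 2×2 matrix of a single-qubit Pauli operator. -/
def Pauli.toMatrix : Pauli → Matrix (Fin 2) (Fin 2) ℂ
  | Pauli.I => !![1, 0; 0, 1]
  | Pauli.X => !![0, 1; 1, 0]
  | Pauli.Y => !![0, -Complex.I; Complex.I, 0]
  | Pauli.Z => !![1, 0; 0, -1]

/-- Operators on `N` qubits. -/
abbrev Op (N : ℕ) : Type := Matrix (Fin N → Fin 2) (Fin N → Fin 2) ℂ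

/-- A Pauli string: one single-qubit Pauli operator for each qubit. -/
abbrev PauliString (N : ℕ) : Type := Fin N → Pauli

/-- The operator of a Pauli string: the tensor product of its single-qubit factors. -/
def PauliString.toOp {N : ℕ} (P : PauliString N) : Op N :=
  Matrix.of fun x y => ∏ q, (P q).toMatrix (x q) (y q)

open Classical in
/-- The support of a Pauli string: the qubits on which it is not the identity. -/
def PauliString.supp {N : ℕ} (P : PauliString N) : Finset (Fin N) :=
  Finset.univ.filter fun q => P q ≠ Pauli.I

section Hamiltonian

variable {N : ℕ} {J : Type*} [Fintype J] (lam : J → ℝ) (h : J → PauliString N)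

/-- The Hamiltonian `H = ∑ j, λ_j h_j`. -/
def hamiltonian : Op N := ∑ j, (lam j : ℂ) • (h j).toOp

open Classical in
/-- The support of `H = ∑ j, λ_j h_j`, for distinct Pauli strings `h_j`: the union of the supports
of the terms that are present. -/
def hamSupp : Finset (Fin N) :=
  (Finset.univ.filter fun j => lam j ≠ 0).biUnion fun j => (h j).supp

open Classical in
/-- The locality `r` of the Hamiltonian: the maximum support size of the terms that are present
(`0` if there are none). -/
def locality : ℕ :=
  (Finset.univ.filter fun j => lam j ≠ 0).sup fun j => (h j).supp.card

/-- The 1-norm of the coefficient vector. -/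
def coeffNorm₁ : ℝ := ∑ j, |lam j|

/-- The 2-norm of the coefficient vector. -/
def coeffNorm₂ : ℝ := Real.sqrt (∑ j, lam j ^ 2)

end Hamiltonian

/-! ### Parametrized circuits made of blocks -/

open Classical in
/-- The operator on `N` qubits that acts as `A` on the qubits in `s` and as the identity on the
others. -/
def embed {N : ℕ} (s : Finset (Fin N)) (A : Matrix (s → Fin 2) (s → Fin 2) ℂ) : Op N :=
  Matrix.of fun x y =>
    if ∀ q, q ∉ s → x q = y q then A (fun q => x q) (fun q => y q) else 0

/-- A parametrized circuit on `N` qubits with parameter space `Θ`, made of `M` blocks. The `k`-th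
block acts on the qubits in `supp k` by the unitary `block k θ`. Blocks with smaller `k` are
applied first. -/
structure Circuit (N M : ℕ) (Θ : Type*) where
  supp : Fin M → Finset (Fin N)
  block : (k : Fin M) → Θ → Matrix.unitaryGroup (supp k → Fin 2) ℂ

namespace Circuit

variable {N M : ℕ} {Θ : Type*} (𝒰 : Circuit N M Θ)

/-- The unitary of the circuit: the product `B_M ⋯ B_2 B_1`, where `B_1` is the first block. -/
def toOp (θ : Θ) : Op N :=
  (List.ofFn fun k => embed (𝒰.supp k) (𝒰.block k θ).1).reverse.prod

/-- The output state: the circuit applied to `|0…0⟩`. -/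
def state (θ : Θ) : (Fin N → Fin 2) → ℂ :=
  𝒰.toOp θ *ᵥ Pi.single 0 1

/-- The cost function `C(θ) = ⟨ψ(θ)| H |ψ(θ)⟩`, a real number since `H` is Hermitian. -/
def cost (H : Op N) (θ : Θ) : ℝ :=
  (star (𝒰.state θ) ⬝ᵥ (H *ᵥ 𝒰.state θ)).re

/-- The qubits on which some block acts. -/
def totalSupp : Finset (Fin N) := Finset.univ.biUnion 𝒰.supp

/-- The local depth at a qubit: the number of blocks acting on it. -/
def localDepth (q : Fin N) : ℕ := (Finset.univ.filter fun k => q ∈ 𝒰.supp k).card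

/-- The maximum local depth `χ`. -/
def maxLocalDepth : ℕ := Finset.univ.sup 𝒰.localDepth

/-- The maximum block size `β`. -/
def maxBlockSize : ℕ := Finset.univ.sup fun k => (𝒰.supp k).card

/-- Under the distribution `μ` of the parameters, the blocks are independent random unitaries, each
of which is a unitary 2-design on its own support. -/
structure IndependentTwoDesigns [MeasurableSpace Θ] (μ : Measure Θ) : Prop where
  measurable : ∀ k, Measurable (𝒰.block k)
  indep : iIndepFun 𝒰.block μ
  design : ∀ k, IsTwoDesign μ (𝒰.block k)

/-- The landscape fluctuation `σ`: the standard deviation of the cost function divided by the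
1-norm of the coefficient vector. -/
def fluctuation [MeasurableSpace Θ] (μ : Measure Θ) {J : Type*} [Fintype J] (lam : J → ℝ)
    (h : J → PauliString N) : ℝ :=
  Real.sqrt (variance (𝒰.cost (hamiltonian lam h)) μ) / coeffNorm₁ lam

end Circuit

end PQC

end

/-! The proof is Pauli propagation in the Heisenberg picture. Conjugating a Pauli string `P` by a
random block `V` gives a combination of the strings obtained from `P` by overwriting its part on the
block, with coefficients `transfer P R V`. Their second moments under the Haar measure follow from
left invariance and Parseval's identity alone, without Weingarten calculus:
* moments of different strings vanish, since some Pauli unitary commutes with one of the two and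
  anticommutes with the other (`integral_haar_transfer_of_ne`);
* for one nontrivial string, different coefficients are uncorrelated, the coefficient of the
  identity vanishes, and every other squared coefficient has mean `1 / (4 ^ n - 1)`, where `n` is
  the number of qubits of the block. The moments do not depend on the nontrivial string, because
  `(P + S) / √2` is a unitary that conjugates `P` to `S` when these anticommute, and Parseval's
  identity gives their sum (`integral_haar_transfer`).

As the blocks are independent, this yields a recursion for the second moments of expectation values
of Pauli strings, by which induction on the number of blocks proves two facts. Strings that differ
on a qubit acted on by a block are uncorrelated (`integral_cost_mul_cost_eq_zero`), which applies to
two distinct terms of the Hamiltonian, and to a term and the identity. Hence the cost has mean zero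
and its variance is the sum of the contributions of the single terms
(`variance_cost_hamiltonian`). In the recursion for a single term all summands are nonnegative, and
the path that turns the string into `Z` wherever a block meets its support leaves the support
unchanged. Each of the at most `r χ` blocks that meet the support costs a factor
`1 / (4 ^ n - 1) ≥ 4 ^ (-β)`, and the final string of `I`s and `Z`s has expectation `1` in `|0…0⟩`
(`le_integral_cost_mul_self`). -/

noncomputable section

namespace PQC

/-! ### Tensor products of single-qubit operators -/

section PauliAlgebra

variable {ι : Type*} [Fintype ι]

/-- The tensor product of one single-qubit operator for each `q : ι`, as a matrix on the
computational basis `ι → Fin 2`. -/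
def tensor (A : ι → Matrix (Fin 2) (Fin 2) ℂ) : Matrix (ι → Fin 2) (ι → Fin 2) ℂ :=
  Matrix.of fun x y => ∏ q, A q (x q) (y q)

lemma tensor_smul (c : ι → ℂ) (A : ι → Matrix (Fin 2) (Fin 2) ℂ) :
    tensor (fun q => c q • A q) = (∏ q, c q) • tensor A := by
  ext x y
  simp [tensor, Finset.prod_mul_distrib]

lemma tensor_conjTranspose (A : ι → Matrix (Fin 2) (Fin 2) ℂ) :
    (tensor A)ᴴ = tensor fun q => (A q)ᴴ := by
  ext x y
  simp [tensor, Matrix.conjTranspose_apply]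

lemma tensor_one : tensor (fun _ : ι => (1 : Matrix (Fin 2) (Fin 2) ℂ)) = 1 := by
  ext x y
  by_cases hxy : x = y
  · subst hxy
    simp [tensor]
  · obtain ⟨q, hq⟩ := Function.ne_iff.mp hxy
    rw [Matrix.one_apply_ne hxy]
    exact Finset.prod_eq_zero (Finset.mem_univ q) (Matrix.one_apply_ne hq)

variable [DecidableEq ι]

lemma tensor_mul (A B : ι → Matrix (Fin 2) (Fin 2) ℂ) :
    tensor A * tensor B = tensor fun q => A q * B q := by
  ext x y
  simp only [tensor, Matrix.mul_apply, Matrix.of_apply, Fintype.prod_sum, Finset.prod_mul_distrib]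

lemma trace_tensor (A : ι → Matrix (Fin 2) (Fin 2) ℂ) :
    (tensor A).trace = ∏ q, (A q).trace := by
  simp only [tensor, Matrix.trace, Matrix.diag_apply, Matrix.of_apply, Fintype.prod_sum]

/-! ### Single-qubit Pauli operators -/

instance : DecidableEq Pauli := fun p q => by
  cases p <;> cases q <;> first | exact isTrue rfl | exact isFalse (by simp)

instance : Fintype Pauli where
  elems := {Pauli.I, Pauli.X, Pauli.Y, Pauli.Z}
  complete p := by cases p <;> decide

lemma Pauli.sum_eq {M : Type*} [AddCommMonoid M] (f : Pauli → M) :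
    ∑ p, f p = f Pauli.I + (f Pauli.X + (f Pauli.Y + f Pauli.Z)) := by
  change ∑ p ∈ ({Pauli.I, Pauli.X, Pauli.Y, Pauli.Z} : Finset Pauli), f p = _
  rw [Finset.sum_insert (by decide), Finset.sum_insert (by decide), Finset.sum_insert (by decide),
    Finset.sum_singleton]

lemma Pauli.card_eq : Fintype.card Pauli = 4 := rfl

lemma Pauli.toMatrix_I : Pauli.I.toMatrix = 1 := by
  ext i j
  fin_cases i <;> fin_cases j <;> simp [Pauli.toMatrix]

lemma Pauli.toMatrix_conjTranspose (p : Pauli) : p.toMatrixᴴ = p.toMatrix := by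
  ext i j
  cases p <;> fin_cases i <;> fin_cases j <;> simp [Pauli.toMatrix, Matrix.conjTranspose_apply]

lemma Pauli.toMatrix_mul_self (p : Pauli) : p.toMatrix * p.toMatrix = 1 := by
  ext i j
  cases p <;> fin_cases i <;> fin_cases j <;> simp [Pauli.toMatrix, Matrix.mul_apply]

lemma Pauli.trace_toMatrix (p : Pauli) (hp : p ≠ Pauli.I) : p.toMatrix.trace = 0 := by
  cases p <;> simp_all [Pauli.toMatrix, Matrix.trace]

/-- The sign `±1` in the commutation relation `p q = ± q p` of two Pauli operators. -/
def Pauli.sign (p q : Pauli) : ℝ :=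
  if p = Pauli.I ∨ q = Pauli.I ∨ p = q then 1 else -1

lemma Pauli.mul_eq_sign_smul (p q : Pauli) :
    p.toMatrix * q.toMatrix = (p.sign q : ℂ) • (q.toMatrix * p.toMatrix) := by
  ext i j
  cases p <;> cases q <;> fin_cases i <;> fin_cases j <;>
    simp [Pauli.toMatrix, Pauli.sign, Matrix.mul_apply]

lemma Pauli.sign_I (p : Pauli) : Pauli.sign Pauli.I p = 1 := by simp [Pauli.sign]

lemma Pauli.exists_sign_mul_sign (p q : Pauli) (hpq : p ≠ q) :
    ∃ w : Pauli, w.sign p * w.sign q = -1 := by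
  cases p <;> cases q <;> first
    | exact absurd rfl hpq
    | (refine ⟨Pauli.X, ?_⟩; simp [Pauli.sign]; done)
    | (refine ⟨Pauli.Y, ?_⟩; simp [Pauli.sign])

lemma Pauli.exists_sign_and_sign (p q : Pauli) (hp : p ≠ Pauli.I) (hq : q ≠ Pauli.I) :
    ∃ w : Pauli, w.sign p = -1 ∧ w.sign q = -1 := by
  cases p <;> cases q <;> first
    | exact absurd rfl hp
    | exact absurd rfl hq
    | (refine ⟨Pauli.X, ?_⟩; simp [Pauli.sign]; done)
    | (refine ⟨Pauli.Y, ?_⟩; simp [Pauli.sign]; done)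
    | (refine ⟨Pauli.Z, ?_⟩; simp [Pauli.sign])

lemma Pauli.sum_mul (i j k l : Fin 2) :
    ∑ p : Pauli, p.toMatrix i j * p.toMatrix k l = if i = l ∧ j = k then 2 else 0 := by
  rw [Pauli.sum_eq]
  fin_cases i <;> fin_cases j <;> fin_cases k <;> fin_cases l <;>
    simp [Pauli.toMatrix] <;> norm_num

/-! ### Pauli strings -/

/-- The operator of a Pauli string on qubits indexed by any finite type. For `ι = Fin N` this is
definitionally `PauliString.toOp`; the general index type serves the qubits of a single block. -/
def pauliOp (P : ι → Pauli) : Matrix (ι → Fin 2) (ι → Fin 2) ℂ :=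
  tensor fun q => (P q).toMatrix

omit [DecidableEq ι] in
lemma pauliOp_I : pauliOp (fun _ : ι => Pauli.I) = 1 := by
  simp only [pauliOp, Pauli.toMatrix_I, tensor_one]

omit [DecidableEq ι] in
lemma pauliOp_conjTranspose (P : ι → Pauli) : (pauliOp P)ᴴ = pauliOp P := by
  simp only [pauliOp, tensor_conjTranspose, Pauli.toMatrix_conjTranspose]

lemma pauliOp_mul_self (P : ι → Pauli) : pauliOp P * pauliOp P = 1 := by
  simp only [pauliOp, tensor_mul, Pauli.toMatrix_mul_self, tensor_one]

lemma trace_pauliOp (P : ι → Pauli) (hP : P ≠ fun _ => Pauli.I) : (pauliOp P).trace = 0 := by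
  obtain ⟨q, hq⟩ := Function.ne_iff.mp hP
  rw [pauliOp, trace_tensor]
  exact Finset.prod_eq_zero (Finset.mem_univ q) (Pauli.trace_toMatrix _ hq)

/-- The sign `±1` in the commutation relation `P Q = ± Q P` of two Pauli strings. -/
def pauliSign (P Q : ι → Pauli) : ℝ := ∏ q, (P q).sign (Q q)

lemma pauliOp_mul_eq_sign_smul (P Q : ι → Pauli) :
    pauliOp P * pauliOp Q = (pauliSign P Q : ℂ) • (pauliOp Q * pauliOp P) := by
  simp only [pauliOp, tensor_mul, pauliSign, Complex.ofReal_prod]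
  rw [← tensor_smul]
  congr 1
  funext q
  exact Pauli.mul_eq_sign_smul _ _

omit [DecidableEq ι] in
lemma pauliSign_I (P : ι → Pauli) : pauliSign (fun _ => Pauli.I) P = 1 := by
  simp [pauliSign, Pauli.sign_I]

lemma pauliSign_update (q : ι) (w : Pauli) (W P : ι → Pauli) (hW : W q = Pauli.I) :
    pauliSign (Function.update W q w) P = w.sign (P q) * pauliSign W P := by
  unfold pauliSign
  rw [← Finset.mul_prod_erase _ _ (Finset.mem_univ q),
    ← Finset.mul_prod_erase (Finset.univ : Finset ι) (fun q => (W q).sign (P q)) (Finset.mem_univ q),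
    hW, Pauli.sign_I, one_mul,
    Function.update_self]
  congr 1
  refine Finset.prod_congr rfl fun i hi => ?_
  rw [Function.update_of_ne (Finset.ne_of_mem_erase hi)]

/-- Distinct Pauli strings are told apart by the sign of their commutation with a third one. -/
lemma exists_pauliSign_mul_pauliSign (P Q : ι → Pauli) (hPQ : P ≠ Q) :
    ∃ W : ι → Pauli, pauliSign W P * pauliSign W Q = -1 := by
  obtain ⟨q, hq⟩ := Function.ne_iff.mp hPQ
  obtain ⟨w, hw⟩ := Pauli.exists_sign_mul_sign _ _ hq
  refine ⟨Function.update (fun _ => Pauli.I) q w, ?_⟩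
  rw [pauliSign_update _ _ _ _ rfl, pauliSign_update _ _ _ _ rfl, pauliSign_I, pauliSign_I, mul_one,
    mul_one, hw]

/-- Any two nontrivial Pauli strings have a common anticommuting one. -/
lemma exists_pauliSign_and_pauliSign (P Q : ι → Pauli) (hP : P ≠ fun _ => Pauli.I)
    (hQ : Q ≠ fun _ => Pauli.I) :
    ∃ W : ι → Pauli, pauliSign W P = -1 ∧ pauliSign W Q = -1 := by
  by_cases h : ∃ q, P q ≠ Pauli.I ∧ Q q ≠ Pauli.I
  · obtain ⟨q, hp, hq⟩ := h
    obtain ⟨w, hw⟩ := Pauli.exists_sign_and_sign _ _ hp hq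
    refine ⟨Function.update (fun _ => Pauli.I) q w, ?_⟩
    rw [pauliSign_update _ _ _ _ rfl, pauliSign_update _ _ _ _ rfl, pauliSign_I, pauliSign_I,
      mul_one, mul_one]
    exact hw
  -- The supports are disjoint: take one factor on each of them.
  · push Not at h
    obtain ⟨p, hp⟩ := Function.ne_iff.mp hP
    obtain ⟨q, hq⟩ := Function.ne_iff.mp hQ
    have hpq : q ≠ p := fun e => hq (e ▸ h p hp)
    have hPq : P q = Pauli.I := by
      by_contra h'
      exact hq (h q h')
    obtain ⟨v, hv, -⟩ := Pauli.exists_sign_and_sign _ _ hp hp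
    obtain ⟨w, hw, -⟩ := Pauli.exists_sign_and_sign _ _ hq hq
    have hI : ∀ u : Pauli, u.sign Pauli.I = 1 := fun u => by simp [Pauli.sign]
    have hQp : Q p = Pauli.I := h p hp
    refine ⟨Function.update (Function.update (fun _ => Pauli.I) p v) q w, ?_⟩
    have hupd : Function.update (fun _ : ι => Pauli.I) p v q = Pauli.I :=
      Function.update_of_ne hpq _ _
    simp only [pauliSign_update q w _ _ hupd, pauliSign_update p v (fun _ => Pauli.I) _ rfl,
      pauliSign_I, hPq, hQp, hI, hv, hw]
    norm_num

/-- Completeness of the Pauli strings, entrywise: `∑ R, R ⊗ R` is `2 ^ n` times the swap. -/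
lemma sum_pauliOp_mul (i j k l : ι → Fin 2) :
    ∑ R : ι → Pauli, pauliOp R i j * pauliOp R k l
      = if i = l ∧ j = k then 2 ^ Fintype.card ι else 0 := by
  have h1 : ∑ R : ι → Pauli, pauliOp R i j * pauliOp R k l
      = ∏ q, if i q = l q ∧ j q = k q then (2 : ℂ) else 0 := by
    simp only [← Pauli.sum_mul, Fintype.prod_sum, pauliOp, tensor, Matrix.of_apply,
      Finset.prod_mul_distrib]
  rw [h1]
  split_ifs with h
  · obtain ⟨rfl, rfl⟩ := h
    simp
  · have : ∃ q, ¬ (i q = l q ∧ j q = k q) := by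
      by_contra! h'
      exact h ⟨funext fun q => (h' q).1, funext fun q => (h' q).2⟩
    obtain ⟨q, hq⟩ := this
    exact Finset.prod_eq_zero (Finset.mem_univ q) (if_neg hq)

/-- Expansion of an operator in the basis of Pauli strings. -/
lemma sum_trace_smul_pauliOp (A : Matrix (ι → Fin 2) (ι → Fin 2) ℂ) :
    ∑ R : ι → Pauli, (pauliOp R * A).trace • pauliOp R = (2 : ℂ) ^ Fintype.card ι • A := by
  ext i j
  simp only [Matrix.sum_apply, Matrix.smul_apply, Matrix.trace, Matrix.diag_apply, Matrix.mul_apply,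
    smul_eq_mul, Finset.sum_mul]
  rw [Finset.sum_comm]
  have h1 : ∀ k : ι → Fin 2, ∑ R : ι → Pauli, ∑ l, pauliOp R k l * A l k * pauliOp R i j
      = ∑ l, A l k * if i = l ∧ j = k then 2 ^ Fintype.card ι else 0 := by
    intro k
    rw [Finset.sum_comm]
    refine Finset.sum_congr rfl fun l _ => ?_
    rw [← sum_pauliOp_mul, Finset.mul_sum]
    exact Finset.sum_congr rfl fun R _ => by ring
  simp only [h1, ite_and, mul_ite, mul_zero, Finset.sum_ite_eq, Finset.mem_univ, if_true]
  ring

/-- Parseval's identity for the Hilbert–Schmidt pairing `tr (A B)`. -/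
lemma sum_trace_mul_trace (A B : Matrix (ι → Fin 2) (ι → Fin 2) ℂ) :
    ∑ R : ι → Pauli, (pauliOp R * A).trace * (pauliOp R * B).trace
      = 2 ^ Fintype.card ι * (A * B).trace := by
  have h := congrArg (fun X => (X * B).trace) (sum_trace_smul_pauliOp A)
  simpa [Finset.sum_mul, Matrix.trace_sum] using h

end PauliAlgebra

/-! ### Moments of degree (2, 2) -/

section Moments

variable {n : Type*} [Fintype n] [DecidableEq n]

lemma continuous_unitaryGroup_apply (a b : n) :
    Continuous fun V : Matrix.unitaryGroup n ℂ => V.1 a b :=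
  (continuous_apply b).comp ((continuous_apply a).comp continuous_subtype_val)

lemma norm_unitaryGroup_apply_le (V : Matrix.unitaryGroup n ℂ) (a b : n) : ‖V.1 a b‖ ≤ 1 :=
  entry_norm_bound_of_unitary V.2 a b

instance : IsProbabilityMeasure (haarUnitary n) :=
  ⟨Measure.haarMeasure_self
    (K₀ := (⊤ : TopologicalSpace.PositiveCompacts (Matrix.unitaryGroup n ℂ)))⟩

instance : (haarUnitary n).IsMulLeftInvariant := by
  unfold haarUnitary
  infer_instance

lemma integrable_moment {Θ : Type*} [MeasurableSpace Θ] (μ : Measure Θ) [IsFiniteMeasure μ]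
    {U : Θ → Matrix.unitaryGroup n ℂ} (hU : Measurable U) (a b c d a' b' c' d' : n) :
    Integrable (fun θ => (U θ).1 a b * (U θ).1 c d * star ((U θ).1 a' b') *
      star ((U θ).1 c' d')) μ := by
  have hm : ∀ i j, Measurable fun θ => (U θ).1 i j := fun i j =>
    (continuous_unitaryGroup_apply i j).measurable.comp hU
  refine Integrable.of_bound (C := 1) ?_ (Filter.Eventually.of_forall fun θ => ?_)
  · refine Measurable.aestronglyMeasurable ?_
    exact (((hm a b).mul (hm c d)).mul (continuous_star.measurable.comp (hm a' b'))).mul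
      (continuous_star.measurable.comp (hm c' d'))
  · simp only [norm_mul, norm_star]
    have h := norm_unitaryGroup_apply_le (U θ)
    exact mul_le_one₀ (mul_le_one₀ (mul_le_one₀ (h a b) (norm_nonneg _) (h c d)) (norm_nonneg _)
      (h a' b')) (norm_nonneg _) (h c' d')

omit [DecidableEq n] in
lemma trace_mul_conj (A B V : Matrix n n ℂ) :
    (B * (Vᴴ * A * V)).trace
      = ∑ p : (n × n) × (n × n),
        B p.1.1 p.1.2 * A p.2.1 p.2.2 * (V p.2.2 p.1.1 * star (V p.2.1 p.1.2)) := by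
  simp only [Matrix.trace, Matrix.diag_apply, Matrix.mul_apply, Matrix.conjTranspose_apply,
    Fintype.sum_prod_type, Finset.mul_sum, Finset.sum_mul]
  refine Finset.sum_congr rfl fun i _ => Finset.sum_congr rfl fun j _ => ?_
  rw [Finset.sum_comm]
  exact Finset.sum_congr rfl fun k _ => Finset.sum_congr rfl fun l _ => by ring

lemma integral_trace_mul_trace {Θ : Type*} [MeasurableSpace Θ] (μ : Measure Θ) [IsFiniteMeasure μ]
    {U : Θ → Matrix.unitaryGroup n ℂ} (hU : Measurable U) (A B C D : Matrix n n ℂ) :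
    ∫ θ, (B * ((U θ).1ᴴ * A * (U θ).1)).trace * (D * ((U θ).1ᴴ * C * (U θ).1)).trace ∂μ
      = ∑ p : (n × n) × (n × n), ∑ q : (n × n) × (n × n),
        B p.1.1 p.1.2 * A p.2.1 p.2.2 * (D q.1.1 q.1.2 * C q.2.1 q.2.2) *
          ∫ θ, (U θ).1 p.2.2 p.1.1 * (U θ).1 q.2.2 q.1.1 * star ((U θ).1 p.2.1 p.1.2) *
            star ((U θ).1 q.2.1 q.1.2) ∂μ := by
  simp only [trace_mul_conj, Finset.sum_mul_sum, ← integral_const_mul]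
  have hint : ∀ p q : (n × n) × (n × n), Integrable (fun θ =>
      B p.1.1 p.1.2 * A p.2.1 p.2.2 * (D q.1.1 q.1.2 * C q.2.1 q.2.2) *
        ((U θ).1 p.2.2 p.1.1 * (U θ).1 q.2.2 q.1.1 * star ((U θ).1 p.2.1 p.1.2) *
            star ((U θ).1 q.2.1 q.1.2))) μ := fun p q =>
    (integrable_moment μ hU _ _ _ _ _ _ _ _).const_mul _
  simp only [← integral_finsetSum Finset.univ fun q _ => hint _ q]
  rw [← integral_finsetSum Finset.univ fun p _ => integrable_finsetSum _ fun q _ => hint p q]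
  refine integral_congr_ae (Filter.Eventually.of_forall fun θ => ?_)
  exact Finset.sum_congr rfl fun p _ => Finset.sum_congr rfl fun q _ => by ring

/-- A 2-design has the same second moments of `U† A U` as the Haar measure. -/
lemma IsTwoDesign.integral_trace_mul_trace {Θ : Type*} [MeasurableSpace Θ] {μ : Measure Θ}
    [IsFiniteMeasure μ] {U : Θ → Matrix.unitaryGroup n ℂ} (hU : Measurable U)
    (h : IsTwoDesign μ U) (A B C D : Matrix n n ℂ) :
    ∫ θ, (B * ((U θ).1ᴴ * A * (U θ).1)).trace * (D * ((U θ).1ᴴ * C * (U θ).1)).trace ∂μ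
      = ∫ V, (B * (V.1ᴴ * A * V.1)).trace * (D * (V.1ᴴ * C * V.1)).trace ∂(haarUnitary n) := by
  rw [PQC.integral_trace_mul_trace μ hU,
    PQC.integral_trace_mul_trace (haarUnitary n) (U := fun V => V) measurable_id]
  exact Finset.sum_congr rfl fun p _ => Finset.sum_congr rfl fun q _ => by rw [h]

end Moments

/-! ### Transfer coefficients between Pauli strings -/

section Transfer

variable {ι : Type*} [Fintype ι] [DecidableEq ι]

/-- The coefficient of the Pauli string `R` in the expansion of `V† P V`. It is real, so that taking
the real part loses nothing, see `ofReal_transfer`. -/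
def transfer (P R : ι → Pauli) (V : Matrix.unitaryGroup (ι → Fin 2) ℂ) : ℝ :=
  (pauliOp R * (V.1ᴴ * pauliOp P * V.1)).trace.re / 2 ^ Fintype.card ι

lemma ofReal_transfer (P R : ι → Pauli) (V : Matrix.unitaryGroup (ι → Fin 2) ℂ) :
    (transfer P R V : ℂ)
      = (pauliOp R * (V.1ᴴ * pauliOp P * V.1)).trace / 2 ^ Fintype.card ι := by
  have h : (starRingEnd ℂ) (pauliOp R * (V.1ᴴ * pauliOp P * V.1)).trace
      = (pauliOp R * (V.1ᴴ * pauliOp P * V.1)).trace := by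
    rw [starRingEnd_apply, ← Matrix.trace_conjTranspose]
    simp only [Matrix.conjTranspose_mul, Matrix.conjTranspose_conjTranspose, pauliOp_conjTranspose]
    rw [Matrix.trace_mul_comm, Matrix.mul_assoc]
  rw [transfer, Complex.ofReal_div, Complex.conj_eq_iff_re.mp h]
  simp

lemma sum_transfer_smul (P : ι → Pauli) (V : Matrix.unitaryGroup (ι → Fin 2) ℂ) :
    V.1ᴴ * pauliOp P * V.1 = ∑ R, (transfer P R V : ℂ) • pauliOp R := by
  have h2 : (2 : ℂ) ^ Fintype.card ι ≠ 0 := pow_ne_zero _ two_ne_zero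
  simp only [ofReal_transfer, div_eq_inv_mul, mul_smul, ← Finset.smul_sum]
  rw [sum_trace_smul_pauliOp, smul_smul, inv_mul_cancel₀ h2, one_smul]

lemma continuous_transfer (P R : ι → Pauli) :
    Continuous fun V : Matrix.unitaryGroup (ι → Fin 2) ℂ => transfer P R V := by
  unfold transfer
  have h : Continuous fun V : Matrix.unitaryGroup (ι → Fin 2) ℂ => V.1 := continuous_subtype_val
  refine (Complex.continuous_re.comp ?_).div_const _
  exact (continuous_const.matrix_mul
    ((h.matrix_conjTranspose.matrix_mul continuous_const).matrix_mul h)).matrix_trace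

lemma exists_abs_transfer_le (P R : ι → Pauli) :
    ∃ C, ∀ V : Matrix.unitaryGroup (ι → Fin 2) ℂ, |transfer P R V| ≤ C := by
  obtain ⟨C, hC⟩ := isCompact_univ.exists_bound_of_continuousOn
    (continuous_transfer P R).continuousOn
  exact ⟨C, fun V => hC V (Set.mem_univ V)⟩

lemma integrable_transfer_mul {Θ : Type*} [MeasurableSpace Θ] (μ : Measure Θ) [IsFiniteMeasure μ]
    {U : Θ → Matrix.unitaryGroup (ι → Fin 2) ℂ} (hU : Measurable U) (P Q R S : ι → Pauli) :
    Integrable (fun θ => transfer P R (U θ) * transfer Q S (U θ)) μ := by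
  obtain ⟨C, hC⟩ := exists_abs_transfer_le P R
  obtain ⟨D, hD⟩ := exists_abs_transfer_le Q S
  refine Integrable.of_bound (C := C * D) ?_ (Filter.Eventually.of_forall fun θ => ?_)
  · exact (((continuous_transfer P R).mul
      (continuous_transfer Q S)).measurable.comp hU).aestronglyMeasurable
  · rw [norm_mul]
    exact mul_le_mul (hC _) (hD _) (norm_nonneg _) ((abs_nonneg _).trans (hC (U θ)))

lemma transfer_I (R : ι → Pauli) (V : Matrix.unitaryGroup (ι → Fin 2) ℂ) :
    transfer (fun _ => Pauli.I) R V = if R = fun _ => Pauli.I then 1 else 0 := by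
  have hV : V.1ᴴ * V.1 = 1 := Matrix.mem_unitaryGroup_iff'.mp V.2
  unfold transfer
  rw [pauliOp_I, Matrix.mul_one, hV, Matrix.mul_one]
  split_ifs with h
  · rw [h, pauliOp_I, Matrix.trace_one]
    simp only [Fintype.card_pi, Fintype.card_fin, Finset.prod_const, Finset.card_univ]
    norm_cast
    exact div_self (by positivity)
  · rw [trace_pauliOp R h]
    simp

lemma transfer_to_I (P : ι → Pauli) (hP : P ≠ fun _ => Pauli.I)
    (V : Matrix.unitaryGroup (ι → Fin 2) ℂ) : transfer P (fun _ => Pauli.I) V = 0 := by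
  have hV : V.1 * V.1ᴴ = 1 := Matrix.mem_unitaryGroup_iff.mp V.2
  unfold transfer
  rw [pauliOp_I, Matrix.one_mul, Matrix.trace_mul_cycle, hV, Matrix.one_mul, trace_pauliOp P hP]
  simp

/-- Parseval's identity for the expansions of `V R V†` and `V S V†`. -/
lemma sum_transfer_mul_transfer (R S : ι → Pauli) (V : Matrix.unitaryGroup (ι → Fin 2) ℂ) :
    ∑ P, transfer P R V * transfer P S V = if R = S then 1 else 0 := by
  have hV : V.1ᴴ * V.1 = 1 := Matrix.mem_unitaryGroup_iff'.mp V.2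
  have h2 : (2 : ℂ) ^ Fintype.card ι ≠ 0 := pow_ne_zero _ two_ne_zero
  have hcyc : ∀ P R : ι → Pauli, (pauliOp R * (V.1ᴴ * pauliOp P * V.1)).trace
      = (pauliOp P * (V.1 * pauliOp R * V.1ᴴ)).trace := by
    intro P R
    rw [Matrix.trace_mul_comm, Matrix.mul_assoc, Matrix.mul_assoc, Matrix.trace_mul_comm,
      Matrix.mul_assoc]
  have hconj : V.1 * pauliOp R * V.1ᴴ * (V.1 * pauliOp S * V.1ᴴ)
      = V.1 * (pauliOp R * pauliOp S) * V.1ᴴ := by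
    calc _ = V.1 * pauliOp R * (V.1ᴴ * V.1) * pauliOp S * V.1ᴴ := by
          simp only [Matrix.mul_assoc]
      _ = _ := by rw [hV]; simp only [Matrix.mul_assoc, Matrix.one_mul]
  have horth : (pauliOp R * pauliOp S).trace = if R = S then (2 : ℂ) ^ Fintype.card ι else 0 := by
    split_ifs with h
    · rw [h, pauliOp_mul_self, Matrix.trace_one]
      simp
    · obtain ⟨q, hq⟩ := Function.ne_iff.mp h
      rw [pauliOp, pauliOp, tensor_mul, trace_tensor]
      refine Finset.prod_eq_zero (Finset.mem_univ q) ?_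
      generalize R q = r at hq
      generalize S q = s at hq
      cases r <;> cases s <;> simp_all [Pauli.toMatrix, Matrix.trace]
  apply Complex.ofReal_injective
  push_cast
  simp only [ofReal_transfer, hcyc]
  have hdiv : ∀ P : ι → Pauli,
      (pauliOp P * (V.1 * pauliOp R * V.1ᴴ)).trace / 2 ^ Fintype.card ι *
        ((pauliOp P * (V.1 * pauliOp S * V.1ᴴ)).trace / 2 ^ Fintype.card ι)
      = ((pauliOp P * (V.1 * pauliOp R * V.1ᴴ)).trace *
        (pauliOp P * (V.1 * pauliOp S * V.1ᴴ)).trace) /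
          (2 ^ Fintype.card ι * 2 ^ Fintype.card ι) := fun P => by rw [div_mul_div_comm]
  simp only [hdiv, ← Finset.sum_div]
  rw [sum_trace_mul_trace, hconj, Matrix.trace_mul_cycle, hV, Matrix.one_mul, horth]
  split_ifs
  · rw [div_self (mul_ne_zero h2 h2), Complex.ofReal_one]
  · simp

lemma transfer_mul_left {P P' : ι → Pauli} {c : ℝ} (W : Matrix.unitaryGroup (ι → Fin 2) ℂ)
    (hW : W.1ᴴ * pauliOp P * W.1 = (c : ℂ) • pauliOp P') (R : ι → Pauli)
    (V : Matrix.unitaryGroup (ι → Fin 2) ℂ) : transfer P R (W * V) = c * transfer P' R V := by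
  apply Complex.ofReal_injective
  rw [Complex.ofReal_mul, ofReal_transfer, ofReal_transfer]
  have h : (W * V).1ᴴ * pauliOp P * (W * V).1 = (c : ℂ) • (V.1ᴴ * pauliOp P' * V.1) := by
    calc (W * V).1ᴴ * pauliOp P * (W * V).1
        = V.1ᴴ * (W.1ᴴ * pauliOp P * W.1) * V.1 := by
          rw [Submonoid.coe_mul, Matrix.conjTranspose_mul]
          simp only [Matrix.mul_assoc]
      _ = _ := by rw [hW]; simp
  rw [h, Matrix.mul_smul, Matrix.trace_smul, smul_eq_mul, mul_div_assoc]

/-- A Pauli string as an element of the unitary group. -/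
def pauliUnitary (W : ι → Pauli) : Matrix.unitaryGroup (ι → Fin 2) ℂ :=
  ⟨pauliOp W, Matrix.mem_unitaryGroup_iff.mpr <| by
    rw [Matrix.star_eq_conjTranspose, pauliOp_conjTranspose, pauliOp_mul_self]⟩

lemma transfer_pauliUnitary_mul (W P R : ι → Pauli) (V : Matrix.unitaryGroup (ι → Fin 2) ℂ) :
    transfer P R (pauliUnitary W * V) = pauliSign W P * transfer P R V := by
  refine transfer_mul_left _ ?_ R V
  simp only [pauliUnitary]
  rw [pauliOp_conjTranspose, pauliOp_mul_eq_sign_smul, Matrix.smul_mul, Matrix.mul_assoc,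
    pauliOp_mul_self, Matrix.mul_one]

/-- For anticommuting Pauli strings `P` and `S`, the Clifford unitary `(P + S) / √2` conjugates `P`
to `S`. -/
lemma exists_conj_eq (P S : ι → Pauli) (hPS : pauliSign S P = -1) :
    ∃ W : Matrix.unitaryGroup (ι → Fin 2) ℂ, W.1ᴴ * pauliOp P * W.1 = pauliOp S := by
  have hanti : pauliOp S * pauliOp P = -(pauliOp P * pauliOp S) := by
    rw [pauliOp_mul_eq_sign_smul, hPS]
    simp
  have hPP := pauliOp_mul_self P
  have hSS := pauliOp_mul_self S
  have hc : ((Real.sqrt 2)⁻¹ : ℂ) * ((Real.sqrt 2)⁻¹ : ℂ) = 1 / 2 := by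
    rw [← Complex.ofReal_inv, ← Complex.ofReal_mul, ← mul_inv, Real.mul_self_sqrt (by norm_num)]
    norm_num
  have hstar : (((Real.sqrt 2)⁻¹ : ℂ) • (pauliOp P + pauliOp S))ᴴ
      = ((Real.sqrt 2)⁻¹ : ℂ) • (pauliOp P + pauliOp S) := by
    rw [Matrix.conjTranspose_smul, Matrix.conjTranspose_add, pauliOp_conjTranspose,
      pauliOp_conjTranspose, ← Complex.ofReal_inv, ← starRingEnd_apply, Complex.conj_ofReal]
  refine ⟨⟨((Real.sqrt 2)⁻¹ : ℂ) • (pauliOp P + pauliOp S),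
    Matrix.mem_unitaryGroup_iff.mpr ?_⟩, ?_⟩
  · rw [Matrix.star_eq_conjTranspose, hstar, Matrix.smul_mul, Matrix.mul_smul, smul_smul, hc,
      Matrix.add_mul, Matrix.mul_add, Matrix.mul_add, hPP, hSS, hanti]
    module
  · change (((Real.sqrt 2)⁻¹ : ℂ) • (pauliOp P + pauliOp S))ᴴ * pauliOp P *
      (((Real.sqrt 2)⁻¹ : ℂ) • (pauliOp P + pauliOp S)) = pauliOp S
    rw [hstar, Matrix.smul_mul, Matrix.smul_mul, Matrix.mul_smul, smul_smul, hc, Matrix.add_mul,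
      hPP, hanti, Matrix.mul_add, Matrix.add_mul, Matrix.add_mul, Matrix.one_mul, Matrix.one_mul,
      Matrix.neg_mul, Matrix.neg_mul, Matrix.mul_assoc (pauliOp P), hanti,
      Matrix.mul_assoc (pauliOp P), hSS, Matrix.mul_neg, ← Matrix.mul_assoc, hPP]
    simp only [Matrix.one_mul, Matrix.mul_one]
    module

/-- Moments of different Pauli strings vanish: translating by a Pauli unitary that commutes with
only one of them flips the sign. -/
lemma integral_haar_transfer_of_ne (P Q R S : ι → Pauli) (hPQ : P ≠ Q) :
    ∫ V, transfer P R V * transfer Q S V ∂(haarUnitary (ι → Fin 2)) = 0 := by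
  obtain ⟨W, hW⟩ := exists_pauliSign_mul_pauliSign P Q hPQ
  have h := integral_mul_left_eq_self (μ := haarUnitary (ι → Fin 2))
    (fun V => transfer P R V * transfer Q S V) (pauliUnitary W)
  have h' : ∀ V, transfer P R (pauliUnitary W * V) * transfer Q S (pauliUnitary W * V)
      = -(transfer P R V * transfer Q S V) := by
    intro V
    rw [transfer_pauliUnitary_mul, transfer_pauliUnitary_mul, mul_mul_mul_comm, hW, neg_one_mul]
  simp only [h', integral_neg] at h
  linarith

lemma integral_haar_transfer_eq (P Q R S : ι → Pauli) (hP : P ≠ fun _ => Pauli.I)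
    (hQ : Q ≠ fun _ => Pauli.I) :
    ∫ V, transfer P R V * transfer P S V ∂(haarUnitary (ι → Fin 2))
      = ∫ V, transfer Q R V * transfer Q S V ∂(haarUnitary (ι → Fin 2)) := by
  obtain ⟨W, hWP, hWQ⟩ := exists_pauliSign_and_pauliSign P Q hP hQ
  have key : ∀ T : ι → Pauli, pauliSign W T = -1 →
      ∫ V, transfer T R V * transfer T S V ∂(haarUnitary (ι → Fin 2))
        = ∫ V, transfer W R V * transfer W S V ∂(haarUnitary (ι → Fin 2)) := by
    intro T hT
    obtain ⟨U, hU⟩ := exists_conj_eq T W hT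
    have hU' : U.1ᴴ * pauliOp T * U.1 = ((1 : ℝ) : ℂ) • pauliOp W := by rw [hU]; simp
    rw [← integral_mul_left_eq_self (fun V => transfer T R V * transfer T S V) U]
    simp only [transfer_mul_left U hU', one_mul]
  rw [key P hWP, key Q hWQ]

/-- The second moments of a nontrivial Pauli string: the expected square of every nontrivial
coefficient is `1 / (4 ^ n - 1)`, and different coefficients are uncorrelated. By invariance the
moments do not depend on `P`, and Parseval's identity gives their sum over all `P`. -/
lemma integral_haar_transfer (P R S : ι → Pauli) (hP : P ≠ fun _ => Pauli.I) :
    ∫ V, transfer P R V * transfer P S V ∂(haarUnitary (ι → Fin 2))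
      = if R = S ∧ R ≠ (fun _ => Pauli.I) then ((4 : ℝ) ^ Fintype.card ι - 1)⁻¹ else 0 := by
  by_cases hR : R = fun _ => Pauli.I
  · simp [hR, transfer_to_I P hP]
  have hsum : ∑ Q, ∫ V, transfer Q R V * transfer Q S V ∂(haarUnitary (ι → Fin 2))
      = if R = S then 1 else 0 := by
    rw [← integral_finsetSum _ fun Q _ => integrable_transfer_mul _ (U := fun V => V)
      measurable_id Q Q R S]
    simp only [sum_transfer_mul_transfer, integral_const, probReal_univ, one_smul]
  rw [← Finset.add_sum_erase _ _ (Finset.mem_univ (fun _ : ι => Pauli.I))] at hsum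
  simp only [transfer_I, if_neg hR, zero_mul, integral_zero, zero_add] at hsum
  rw [Finset.sum_congr rfl fun Q hQ => integral_haar_transfer_eq Q P R S
    (Finset.ne_of_mem_erase hQ) hP, Finset.sum_const, Finset.card_erase_of_mem (Finset.mem_univ _),
    Finset.card_univ, Fintype.card_fun, Pauli.card_eq, nsmul_eq_mul,
    Nat.cast_sub (Nat.one_le_pow _ _ (by norm_num))] at hsum
  push_cast at hsum
  have hcard : (4 : ℝ) ^ Fintype.card ι - 1 ≠ 0 := by
    obtain ⟨q, -⟩ := Function.ne_iff.mp hP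
    have : (1 : ℝ) < 4 ^ Fintype.card ι :=
      one_lt_pow₀ (by norm_num) (Fintype.card_pos_iff.mpr ⟨q⟩).ne'
    linarith
  simp only [ne_eq, hR, not_false_eq_true, and_true]
  split_ifs at hsum ⊢ with h
  · exact eq_inv_of_mul_eq_one_right hsum
  · exact (mul_eq_zero.mp hsum).resolve_left hcard

lemma IsTwoDesign.integral_transfer {Θ : Type*} [MeasurableSpace Θ] {μ : Measure Θ}
    [IsFiniteMeasure μ] {U : Θ → Matrix.unitaryGroup (ι → Fin 2) ℂ} (hU : Measurable U)
    (h : IsTwoDesign μ U) (P Q R S : ι → Pauli) :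
    ∫ θ, transfer P R (U θ) * transfer Q S (U θ) ∂μ
      = ∫ V, transfer P R V * transfer Q S V ∂(haarUnitary (ι → Fin 2)) := by
  apply Complex.ofReal_injective
  simp only [← integral_complex_ofReal, Complex.ofReal_mul, ofReal_transfer, div_mul_div_comm,
    integral_div]
  rw [h.integral_trace_mul_trace hU]

end Transfer

/-! ### Conjugating a Pauli string by a block -/

section Block

open scoped Kronecker

variable {N : ℕ} (s : Finset (Fin N))

/-- The restriction of a Pauli string to the qubits in `s`. -/
def PauliString.restrict (P : PauliString N) : s → Pauli := fun q => P q

/-- The Pauli string that agrees with `R` on the qubits in `s` and with `P` on the others. -/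
def PauliString.overwrite (P : PauliString N) (R : s → Pauli) : PauliString N :=
  fun q => if h : q ∈ s then R ⟨q, h⟩ else P q

lemma PauliString.overwrite_of_mem (P : PauliString N) (R : s → Pauli) {q : Fin N} (hq : q ∈ s) :
    P.overwrite s R q = R ⟨q, hq⟩ := dif_pos hq

lemma PauliString.overwrite_of_notMem (P : PauliString N) (R : s → Pauli) {q : Fin N}
    (hq : q ∉ s) : P.overwrite s R q = P q := dif_neg hq

lemma PauliString.overwrite_restrict (P : PauliString N) : P.overwrite s (P.restrict s) = P := by
  funext q
  by_cases hq : q ∈ s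
  · exact P.overwrite_of_mem s _ hq
  · exact P.overwrite_of_notMem s _ hq

/-- Splitting the computational basis into the qubits in `s` and the others. -/
abbrev splitBasis : (Fin N → Fin 2) ≃ (s → Fin 2) × ({q // q ∉ s} → Fin 2) :=
  Equiv.piEquivPiSubtypeProd (· ∈ s) fun _ => Fin 2

lemma embed_eq_submatrix (A : Matrix (s → Fin 2) (s → Fin 2) ℂ) :
    embed s A = (A ⊗ₖ (1 : Matrix ({q // q ∉ s} → Fin 2) ({q // q ∉ s} → Fin 2) ℂ)).submatrix
      (splitBasis s) (splitBasis s) := by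
  ext x y
  have h : (∀ q, q ∉ s → x q = y q) ↔
      (fun q : {q // q ∉ s} => x q) = fun q : {q // q ∉ s} => y q :=
    ⟨fun h => funext fun q => h q q.2, fun h q hq => congrFun h ⟨q, hq⟩⟩
  simp only [embed, Matrix.of_apply, h, Matrix.submatrix_apply, Matrix.kroneckerMap_apply,
    splitBasis, Equiv.piEquivPiSubtypeProd_apply, Matrix.one_apply, mul_ite, mul_one, mul_zero]

lemma toOp_overwrite_eq_submatrix (P : PauliString N) (R : s → Pauli) :
    (P.overwrite s R).toOp = (pauliOp R ⊗ₖ pauliOp fun q : {q // q ∉ s} => P q).submatrix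
      (splitBasis s) (splitBasis s) := by
  ext x y
  simp only [PauliString.toOp, pauliOp, tensor, Matrix.of_apply, Matrix.submatrix_apply,
    Matrix.kroneckerMap_apply, splitBasis, Equiv.piEquivPiSubtypeProd_apply]
  rw [← Fintype.prod_subtype_mul_prod_subtype (· ∈ s)]
  congr 1
  · exact Finset.prod_congr (by ext; simp) fun q _ => by rw [P.overwrite_of_mem s R q.2]
  · exact Finset.prod_congr rfl fun q _ => by rw [P.overwrite_of_notMem s R q.2]

lemma embed_conj_toOp (P : PauliString N) (V : Matrix.unitaryGroup (s → Fin 2) ℂ) :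
    (embed s V.1)ᴴ * P.toOp * embed s V.1
      = ∑ R, (transfer (P.restrict s) R V : ℂ) • (P.overwrite s R).toOp := by
  nth_rw 1 [← P.overwrite_restrict s]
  simp only [toOp_overwrite_eq_submatrix, embed_eq_submatrix, Matrix.conjTranspose_submatrix,
    Matrix.submatrix_mul_equiv, Matrix.conjTranspose_kronecker, ← Matrix.mul_kronecker_mul,
    Matrix.conjTranspose_one, Matrix.one_mul, Matrix.mul_one, sum_transfer_smul]
  ext x y
  simp only [Matrix.submatrix_apply, Matrix.kroneckerMap_apply, Matrix.sum_apply,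
    Matrix.smul_apply, Finset.sum_mul, smul_eq_mul, mul_assoc]

end Block

/-! ### Circuits without their last block -/

namespace Circuit

variable {N M : ℕ} {Θ : Type*}

/-- The circuit without its last block. -/
def init (𝒰 : Circuit N (M + 1) Θ) : Circuit N M Θ where
  supp k := 𝒰.supp k.castSucc
  block k := 𝒰.block k.castSucc

/-- The circuit whose parameters are the blocks themselves. -/
def ofBlocks (s : Fin M → Finset (Fin N)) :
    Circuit N M ((k : Fin M) → Matrix.unitaryGroup (s k → Fin 2) ℂ) where
  supp := s
  block k V := V k

lemma toOp_succ (𝒰 : Circuit N (M + 1) Θ) (θ : Θ) :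
    𝒰.toOp θ = embed (𝒰.supp (Fin.last M)) (𝒰.block (Fin.last M) θ).1 * 𝒰.init.toOp θ := by
  simp only [toOp, List.ofFn_succ', List.concat_eq_append, List.reverse_append,
    List.reverse_singleton, List.singleton_append, List.prod_cons]
  rfl

lemma cost_succ (𝒰 : Circuit N (M + 1) Θ) (H : Op N) (θ : Θ) :
    𝒰.cost H θ = 𝒰.init.cost ((embed (𝒰.supp (Fin.last M)) (𝒰.block (Fin.last M) θ).1)ᴴ * H *
      embed (𝒰.supp (Fin.last M)) (𝒰.block (Fin.last M) θ).1) θ := by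
  simp only [cost, state, toOp_succ, ← Matrix.mulVec_mulVec]
  rw [Matrix.star_mulVec, ← Matrix.dotProduct_mulVec]

lemma cost_sum_smul (𝒰 : Circuit N M Θ) {J : Type*} [Fintype J] (c : J → ℝ) (A : J → Op N)
    (θ : Θ) : 𝒰.cost (∑ j, (c j : ℂ) • A j) θ = ∑ j, c j * 𝒰.cost (A j) θ := by
  simp only [cost, Matrix.sum_mulVec, dotProduct_sum, Matrix.smul_mulVec, dotProduct_smul,
    Complex.re_sum, smul_eq_mul, Complex.re_ofReal_mul]

/-- The recursion for expectation values of Pauli strings in the Heisenberg picture. -/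
lemma cost_toOp_succ (𝒰 : Circuit N (M + 1) Θ) (P : PauliString N) (θ : Θ) :
    𝒰.cost P.toOp θ = ∑ R, transfer (P.restrict (𝒰.supp (Fin.last M))) R
      (𝒰.block (Fin.last M) θ) * 𝒰.init.cost (P.overwrite (𝒰.supp (Fin.last M)) R).toOp θ := by
  rw [cost_succ, embed_conj_toOp, cost_sum_smul]

lemma cost_toOp_zero (𝒰 : Circuit N 0 Θ) (P : PauliString N) (θ : Θ) :
    𝒰.cost P.toOp θ = (P.toOp 0 0).re := by
  have h : star (Pi.single 0 1 : (Fin N → Fin 2) → ℂ) = Pi.single 0 1 := by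
    rw [← Pi.single_star, star_one]
  have hs : 𝒰.state θ = Pi.single 0 1 := by
    rw [state, toOp, List.ofFn_zero, List.reverse_nil, List.prod_nil, Matrix.one_mulVec]
  rw [cost, hs, h, Matrix.mulVec_single_one, single_one_dotProduct]
  rfl

lemma cost_toOp_I (𝒰 : Circuit N M Θ) (θ : Θ) :
    𝒰.cost (PauliString.toOp fun _ => Pauli.I) θ = 1 := by
  induction M with
  | zero =>
    rw [cost_toOp_zero]
    simp [PauliString.toOp, Pauli.toMatrix]
  | succ M ih =>
    rw [cost_toOp_succ]
    have hr : PauliString.restrict (𝒰.supp (Fin.last M)) (fun _ => Pauli.I)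
        = fun _ => Pauli.I := rfl
    simp only [hr, transfer_I, ite_mul, one_mul, zero_mul, Finset.sum_ite_eq', Finset.mem_univ,
      if_true]
    rw [← hr, PauliString.overwrite_restrict]
    exact ih 𝒰.init

lemma exists_abs_cost_toOp_le (𝒰 : Circuit N M Θ) (P : PauliString N) :
    ∃ C, ∀ θ, |𝒰.cost P.toOp θ| ≤ C := by
  induction M generalizing P with
  | zero => exact ⟨|(P.toOp 0 0).re|, fun θ => by rw [cost_toOp_zero]⟩
  | succ M ih =>
    choose C hC using fun R => exists_abs_transfer_le (P.restrict (𝒰.supp (Fin.last M))) R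
    choose D hD using fun R => ih 𝒰.init (P.overwrite (𝒰.supp (Fin.last M)) R)
    refine ⟨∑ R, C R * D R, fun θ => ?_⟩
    rw [cost_toOp_succ]
    refine (Finset.abs_sum_le_sum_abs _ _).trans (Finset.sum_le_sum fun R _ => ?_)
    rw [abs_mul]
    exact mul_le_mul (hC R _) (hD R θ) (abs_nonneg _) ((abs_nonneg _).trans (hC R 1))

variable [MeasurableSpace Θ]

lemma measurable_cost_toOp (𝒰 : Circuit N M Θ) (h : ∀ k, Measurable (𝒰.block k))
    (P : PauliString N) : Measurable (𝒰.cost P.toOp) := by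
  induction M generalizing P with
  | zero =>
    rw [funext (𝒰.cost_toOp_zero P)]
    exact measurable_const
  | succ M ih =>
    rw [funext (𝒰.cost_toOp_succ P)]
    exact Finset.measurable_fun_sum _ fun R _ =>
      ((continuous_transfer _ R).measurable.comp (h _)).mul
        (ih 𝒰.init (fun k => h k.castSucc) _)

lemma integrable_cost_mul_cost (μ : Measure Θ) [IsFiniteMeasure μ] (𝒰 : Circuit N M Θ)
    (h : ∀ k, Measurable (𝒰.block k)) (P Q : PauliString N) :
    Integrable (fun θ => 𝒰.cost P.toOp θ * 𝒰.cost Q.toOp θ) μ := by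
  obtain ⟨C, hC⟩ := 𝒰.exists_abs_cost_toOp_le P
  obtain ⟨D, hD⟩ := 𝒰.exists_abs_cost_toOp_le Q
  refine Integrable.of_bound (C := C * D) ?_ (Filter.Eventually.of_forall fun θ => ?_)
  · exact ((𝒰.measurable_cost_toOp h P).mul (𝒰.measurable_cost_toOp h Q)).aestronglyMeasurable
  · rw [norm_mul]
    exact mul_le_mul (hC θ) (hD θ) (norm_nonneg _) ((abs_nonneg _).trans (hC θ))

namespace IndependentTwoDesigns

variable {μ : Measure Θ}

lemma init {𝒰 : Circuit N (M + 1) Θ} (h : 𝒰.IndependentTwoDesigns μ) :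
    𝒰.init.IndependentTwoDesigns μ where
  measurable k := h.measurable k.castSucc
  indep := h.indep.precomp (g := Fin.castSucc) (Fin.castSucc_injective M)
  design k := h.design k.castSucc

lemma indepFun_last_init {𝒰 : Circuit N (M + 1) Θ} (h : 𝒰.IndependentTwoDesigns μ) :
    IndepFun (𝒰.block (Fin.last M)) (fun θ k => 𝒰.init.block k θ) μ := by
  have hd := h.indep.indepFun_finset {Fin.last M} {Fin.last M}ᶜ disjoint_compl_right h.measurable
  have hk : ∀ k : Fin M, k.castSucc ∈ ({Fin.last M}ᶜ : Finset (Fin (M + 1))) := fun k => by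
    simp [Fin.castSucc_ne_last]
  have hlast : Measurable fun v : (i : ({Fin.last M} : Finset (Fin (M + 1)))) →
      Matrix.unitaryGroup (𝒰.supp i → Fin 2) ℂ => v ⟨Fin.last M, Finset.mem_singleton_self _⟩ :=
    measurable_pi_apply _
  have hinit : Measurable fun (v : (i : ({Fin.last M}ᶜ : Finset (Fin (M + 1)))) →
      Matrix.unitaryGroup (𝒰.supp i → Fin 2) ℂ) (k : Fin M) => v ⟨k.castSucc, hk k⟩ :=
    measurable_pi_lambda _ fun k => measurable_pi_apply _
  exact hd.comp hlast hinit

/-! ### Second moments of expectation values of Pauli strings -/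

/-- The recursion for second moments: the last block contributes Haar moments, by the 2-design
property, and the remaining circuit is independent of it. -/
lemma integral_cost_mul_cost_succ [IsProbabilityMeasure μ] {𝒰 : Circuit N (M + 1) Θ}
    (h : 𝒰.IndependentTwoDesigns μ) (P Q : PauliString N) :
    ∫ θ, 𝒰.cost P.toOp θ * 𝒰.cost Q.toOp θ ∂μ
      = ∑ R, ∑ S,
        (∫ V, transfer (P.restrict (𝒰.supp (Fin.last M))) R V *
          transfer (Q.restrict (𝒰.supp (Fin.last M))) S V ∂(haarUnitary _)) *
        ∫ θ, 𝒰.init.cost (P.overwrite (𝒰.supp (Fin.last M)) R).toOp θ *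
          𝒰.init.cost (Q.overwrite (𝒰.supp (Fin.last M)) S).toOp θ ∂μ := by
  have hV := h.measurable (Fin.last M)
  have hm := fun P => 𝒰.init.measurable_cost_toOp h.init.measurable P
  have hind : ∀ R S : 𝒰.supp (Fin.last M) → Pauli, IndepFun
      (fun θ => transfer (P.restrict (𝒰.supp (Fin.last M))) R (𝒰.block (Fin.last M) θ) *
        transfer (Q.restrict (𝒰.supp (Fin.last M))) S (𝒰.block (Fin.last M) θ))
      (fun θ => 𝒰.init.cost (P.overwrite (𝒰.supp (Fin.last M)) R).toOp θ *
        𝒰.init.cost (Q.overwrite (𝒰.supp (Fin.last M)) S).toOp θ) μ := by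
    intro R S
    have hb := fun P : PauliString N => (ofBlocks 𝒰.init.supp).measurable_cost_toOp
      (fun k => measurable_pi_apply k) P
    exact h.indepFun_last_init.comp
      ((continuous_transfer (P.restrict (𝒰.supp (Fin.last M))) R).mul
        (continuous_transfer (Q.restrict (𝒰.supp (Fin.last M))) S)).measurable
      ((hb (P.overwrite (𝒰.supp (Fin.last M)) R)).mul (hb (Q.overwrite (𝒰.supp (Fin.last M)) S)))
  have hI : ∀ R S : 𝒰.supp (Fin.last M) → Pauli, Integrable (fun θ =>
      (transfer (P.restrict (𝒰.supp (Fin.last M))) R (𝒰.block (Fin.last M) θ) *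
        transfer (Q.restrict (𝒰.supp (Fin.last M))) S (𝒰.block (Fin.last M) θ)) *
      (𝒰.init.cost (P.overwrite (𝒰.supp (Fin.last M)) R).toOp θ *
        𝒰.init.cost (Q.overwrite (𝒰.supp (Fin.last M)) S).toOp θ)) μ := fun R S =>
    (hind R S).integrable_mul (integrable_transfer_mul μ hV _ _ R S)
      (𝒰.init.integrable_cost_mul_cost μ h.init.measurable _ _)
  have hprod : ∀ R S : 𝒰.supp (Fin.last M) → Pauli, _ := fun R S =>
    (hind R S).integral_fun_mul_eq_mul_integral
      (integrable_transfer_mul μ hV _ _ R S).aestronglyMeasurable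
      (𝒰.init.integrable_cost_mul_cost μ h.init.measurable _ _).aestronglyMeasurable
  simp only [← (h.design (Fin.last M)).integral_transfer hV, ← hprod]
  simp only [← integral_finsetSum Finset.univ fun S _ => hI _ S]
  rw [← integral_finsetSum Finset.univ fun R _ => integrable_finsetSum _ fun S _ => hI R S]
  refine integral_congr_ae (Filter.Eventually.of_forall fun θ => ?_)
  simp only [cost_toOp_succ, Finset.sum_mul_sum]
  exact Finset.sum_congr rfl fun R _ => Finset.sum_congr rfl fun S _ => by ring

lemma integral_cost_mul_cost_succ_of_eq_I [IsProbabilityMeasure μ] {𝒰 : Circuit N (M + 1) Θ}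
    (h : 𝒰.IndependentTwoDesigns μ) (P Q : PauliString N)
    (hP : P.restrict (𝒰.supp (Fin.last M)) = fun _ => Pauli.I)
    (hQ : Q.restrict (𝒰.supp (Fin.last M)) = fun _ => Pauli.I) :
    ∫ θ, 𝒰.cost P.toOp θ * 𝒰.cost Q.toOp θ ∂μ
      = ∫ θ, 𝒰.init.cost P.toOp θ * 𝒰.init.cost Q.toOp θ ∂μ := by
  rw [h.integral_cost_mul_cost_succ, hP, hQ]
  simp only [transfer_I, mul_ite, mul_one, mul_zero]
  rw [Finset.sum_eq_single (fun _ => Pauli.I), Finset.sum_eq_single (fun _ => Pauli.I)]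
  · simp only [if_true, integral_const, probReal_univ, one_smul, one_mul]
    rw [← hP, P.overwrite_restrict, hP, ← hQ, Q.overwrite_restrict]
  · intro S _ hS
    simp [hS]
  · simp
  · intro R _ hR
    simp [hR]
  · simp

lemma integral_cost_mul_cost_succ_of_ne_I [IsProbabilityMeasure μ] {𝒰 : Circuit N (M + 1) Θ}
    (h : 𝒰.IndependentTwoDesigns μ) (P Q : PauliString N)
    (hPQ : P.restrict (𝒰.supp (Fin.last M)) = Q.restrict (𝒰.supp (Fin.last M)))
    (hP : P.restrict (𝒰.supp (Fin.last M)) ≠ fun _ => Pauli.I) :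
    ∫ θ, 𝒰.cost P.toOp θ * 𝒰.cost Q.toOp θ ∂μ
      = ∑ R ∈ Finset.univ.erase (fun _ => Pauli.I),
        ((4 : ℝ) ^ (𝒰.supp (Fin.last M)).card - 1)⁻¹ *
        ∫ θ, 𝒰.init.cost (P.overwrite (𝒰.supp (Fin.last M)) R).toOp θ *
          𝒰.init.cost (Q.overwrite (𝒰.supp (Fin.last M)) R).toOp θ ∂μ := by
  rw [h.integral_cost_mul_cost_succ, ← hPQ]
  simp only [integral_haar_transfer _ _ _ hP, Fintype.card_coe]
  rw [← Finset.add_sum_erase _ _ (Finset.mem_univ (fun _ => Pauli.I))]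
  simp only [ne_eq, not_true_eq_false, and_false, if_false, zero_mul, Finset.sum_const_zero,
    zero_add]
  refine Finset.sum_congr rfl fun R hR => ?_
  simp [Finset.ne_of_mem_erase hR]

/-- Expectation values of Pauli strings that differ on a qubit acted on by a block are
uncorrelated. -/
lemma integral_cost_mul_cost_eq_zero [IsProbabilityMeasure μ] {𝒰 : Circuit N M Θ}
    (h : 𝒰.IndependentTwoDesigns μ) (P Q : PauliString N) {q : Fin N} (hq : q ∈ 𝒰.totalSupp)
    (hPQ : P q ≠ Q q) : ∫ θ, 𝒰.cost P.toOp θ * 𝒰.cost Q.toOp θ ∂μ = 0 := by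
  induction M generalizing P Q with
  | zero => simp [totalSupp] at hq
  | succ M ih =>
    by_cases hres : P.restrict (𝒰.supp (Fin.last M)) = Q.restrict (𝒰.supp (Fin.last M))
    · have hqs : q ∉ 𝒰.supp (Fin.last M) := fun hqs => hPQ (congrFun hres ⟨q, hqs⟩)
      have hq' : q ∈ 𝒰.init.totalSupp := by
        simp only [totalSupp, Finset.mem_biUnion, Finset.mem_univ, true_and] at hq ⊢
        obtain ⟨k, hk⟩ := hq
        induction k using Fin.lastCases with
        | last => exact absurd hk hqs
        | cast k => exact ⟨k, hk⟩
      by_cases hI : P.restrict (𝒰.supp (Fin.last M)) = fun _ => Pauli.I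
      · rw [h.integral_cost_mul_cost_succ_of_eq_I P Q hI (hres ▸ hI)]
        exact ih h.init P Q hq' hPQ
      · rw [h.integral_cost_mul_cost_succ_of_ne_I P Q hres hI]
        refine Finset.sum_eq_zero fun R _ => ?_
        rw [ih h.init _ _ hq', mul_zero]
        rwa [P.overwrite_of_notMem _ R hqs, Q.overwrite_of_notMem _ R hqs]
    · rw [h.integral_cost_mul_cost_succ]
      refine Finset.sum_eq_zero fun R _ => Finset.sum_eq_zero fun S _ => ?_
      rw [integral_haar_transfer_of_ne _ _ _ _ hres, zero_mul]

/-- Lower bound for the second moment of a Pauli string, where `b` bounds the size of the blocks: one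
factor `4 ^ (-b)` for each pair of a qubit in the support and a block acting on it. Only one path of
the Pauli propagation is kept: each block that meets the support turns `P` into `Z` on the qubits
where they meet, so that the support does not change and at the end only `I` and `Z` are left. -/
lemma le_integral_cost_mul_self [IsProbabilityMeasure μ] {𝒰 : Circuit N M Θ}
    (h : 𝒰.IndependentTwoDesigns μ) {b : ℕ} (hb : ∀ k, (𝒰.supp k).card ≤ b) (P : PauliString N)
    (hP : ∀ q, q ∉ 𝒰.totalSupp → P q = Pauli.I ∨ P q = Pauli.Z) :
    (((4 : ℝ) ^ b)⁻¹) ^ (∑ q ∈ P.supp, 𝒰.localDepth q)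
      ≤ ∫ θ, 𝒰.cost P.toOp θ * 𝒰.cost P.toOp θ ∂μ := by
  have hnonneg : (0 : ℝ) ≤ ((4 : ℝ) ^ b)⁻¹ := by positivity
  have hle1 : ((4 : ℝ) ^ b)⁻¹ ≤ 1 := inv_le_one_of_one_le₀ (one_le_pow₀ (by norm_num))
  induction M generalizing P with
  | zero =>
    have h1 : ∀ q, (P q).toMatrix 0 0 = 1 := fun q => by
      rcases hP q (by simp [totalSupp]) with h | h <;> simp [h, Pauli.toMatrix]
    have h2 : P.toOp 0 0 = 1 := by
      simp only [PauliString.toOp, Matrix.of_apply]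
      exact Finset.prod_eq_one fun q _ => h1 q
    simp [cost_toOp_zero, h2, localDepth]
  | succ M ih =>
    have hsupp : ∀ q, q ∉ 𝒰.supp (Fin.last M) → q ∉ 𝒰.init.totalSupp → q ∉ 𝒰.totalSupp := by
      intro q h1 h2 h3
      simp only [totalSupp, Finset.mem_biUnion, Finset.mem_univ, true_and] at h2 h3
      obtain ⟨k, hk⟩ := h3
      induction k using Fin.lastCases with
      | last => exact h1 hk
      | cast k => exact h2 ⟨k, hk⟩
    have hdepth : ∀ q, 𝒰.localDepth q
        = 𝒰.init.localDepth q + if q ∈ 𝒰.supp (Fin.last M) then 1 else 0 := by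
      intro q
      simp only [localDepth, Finset.card_filter, Fin.sum_univ_castSucc]
      rfl
    by_cases hI : P.restrict (𝒰.supp (Fin.last M)) = fun _ => Pauli.I
    · rw [h.integral_cost_mul_cost_succ_of_eq_I P P hI hI]
      have hP' : ∀ q, q ∉ 𝒰.init.totalSupp → P q = Pauli.I ∨ P q = Pauli.Z := by
        intro q hq
        by_cases hqs : q ∈ 𝒰.supp (Fin.last M)
        · exact Or.inl (congrFun hI ⟨q, hqs⟩)
        · exact hP q (hsupp q hqs hq)
      refine le_trans ?_ (ih h.init (fun k => hb k.castSucc) P hP')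
      exact pow_le_pow_of_le_one hnonneg hle1
        (Finset.sum_le_sum fun q _ => (hdepth q).symm ▸ Nat.le_add_right _ _)
    · rw [h.integral_cost_mul_cost_succ_of_ne_I P P rfl hI]
      obtain ⟨⟨q₀, hq₀⟩, hPq₀⟩ := Function.ne_iff.mp hI
      set R : 𝒰.supp (Fin.last M) → Pauli :=
        fun q => if P q = Pauli.I then Pauli.I else Pauli.Z with hR
      have hRI : R ≠ fun _ => Pauli.I := Function.ne_iff.mpr ⟨⟨q₀, hq₀⟩, by
        have : P q₀ ≠ Pauli.I := hPq₀
        simp [hR, this]⟩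
      have hsuppR : (P.overwrite _ R).supp = P.supp := by
        ext q
        simp only [PauliString.supp, Finset.mem_filter, Finset.mem_univ, true_and]
        by_cases hqs : q ∈ 𝒰.supp (Fin.last M)
        · rw [P.overwrite_of_mem _ R hqs]
          by_cases hPq : P q = Pauli.I <;> simp [hR, hPq]
        · rw [P.overwrite_of_notMem _ R hqs]
      have hPR : ∀ q, q ∉ 𝒰.init.totalSupp →
          P.overwrite _ R q = Pauli.I ∨ P.overwrite _ R q = Pauli.Z := by
        intro q hq
        by_cases hqs : q ∈ 𝒰.supp (Fin.last M)
        · rw [P.overwrite_of_mem _ R hqs]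
          by_cases hPq : P q = Pauli.I <;> simp [hR, hPq]
        · rw [P.overwrite_of_notMem _ R hqs]
          exact hP q (hsupp q hqs hq)
      have hrec := ih h.init (fun k => hb k.castSucc) _ hPR
      rw [hsuppR] at hrec
      have hlt : (∑ q ∈ P.supp, 𝒰.init.localDepth q) + 1 ≤ ∑ q ∈ P.supp, 𝒰.localDepth q := by
        refine Finset.sum_lt_sum (fun q _ => (hdepth q).symm ▸ Nat.le_add_right _ _) ⟨q₀, ?_, ?_⟩
        · simp only [PauliString.supp, Finset.mem_filter, Finset.mem_univ, true_and]
          exact hPq₀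
        · rw [hdepth, if_pos hq₀]
          exact Nat.lt_succ_self _
      have hone : (1 : ℝ) < 4 ^ (𝒰.supp (Fin.last M)).card :=
        one_lt_pow₀ (by norm_num) (Finset.card_ne_zero_of_mem hq₀)
      have hcoef : ((4 : ℝ) ^ b)⁻¹ ≤ ((4 : ℝ) ^ (𝒰.supp (Fin.last M)).card - 1)⁻¹ := by
        refine inv_anti₀ (by linarith) ?_
        have : (4 : ℝ) ^ (𝒰.supp (Fin.last M)).card ≤ 4 ^ b :=
          pow_le_pow_right₀ (by norm_num) (hb _)
        linarith
      calc (((4 : ℝ) ^ b)⁻¹) ^ (∑ q ∈ P.supp, 𝒰.localDepth q)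
          ≤ (((4 : ℝ) ^ b)⁻¹) ^ ((∑ q ∈ P.supp, 𝒰.init.localDepth q) + 1) :=
            pow_le_pow_of_le_one hnonneg hle1 hlt
        _ = ((4 : ℝ) ^ b)⁻¹ * (((4 : ℝ) ^ b)⁻¹) ^ (∑ q ∈ P.supp, 𝒰.init.localDepth q) :=
            pow_succ' _ _
        _ ≤ ((4 : ℝ) ^ (𝒰.supp (Fin.last M)).card - 1)⁻¹ *
            ∫ θ, 𝒰.init.cost (P.overwrite (𝒰.supp (Fin.last M)) R).toOp θ *
              𝒰.init.cost (P.overwrite (𝒰.supp (Fin.last M)) R).toOp θ ∂μ :=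
            mul_le_mul hcoef hrec (pow_nonneg hnonneg _) (hnonneg.trans hcoef)
        _ ≤ _ := Finset.single_le_sum (f := fun R =>
            ((4 : ℝ) ^ (𝒰.supp (Fin.last M)).card - 1)⁻¹ *
              ∫ θ, 𝒰.init.cost (P.overwrite (𝒰.supp (Fin.last M)) R).toOp θ *
                𝒰.init.cost (P.overwrite (𝒰.supp (Fin.last M)) R).toOp θ ∂μ)
            (fun S _ => mul_nonneg (hnonneg.trans hcoef)
              (integral_nonneg fun θ => mul_self_nonneg _))
            (Finset.mem_erase.mpr ⟨hRI, Finset.mem_univ R⟩)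

end IndependentTwoDesigns

end Circuit

/-! ### Variance of the cost function -/

lemma ne_I_of_trace_hamiltonian_eq_zero {N : ℕ} {J : Type*} [Fintype J] {lam : J → ℝ}
    {h : J → PauliString N} (hinj : Function.Injective h) (htrace : (hamiltonian lam h).trace = 0)
    {j : J} (hj : lam j ≠ 0) : h j ≠ fun _ => Pauli.I := by
  intro hI
  refine hj ?_
  have h1 : (hamiltonian lam h).trace = (lam j : ℂ) * (h j).toOp.trace := by
    rw [hamiltonian, Matrix.trace_sum, Finset.sum_eq_single j, Matrix.trace_smul, smul_eq_mul]
    · intro i _ hij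
      have : (h i).toOp.trace = 0 := trace_pauliOp (h i) fun hi => hij (hinj (hi.trans hI.symm))
      rw [Matrix.trace_smul, this, smul_zero]
    · simp
  have h2 : (h j).toOp.trace = 2 ^ N := by
    change (pauliOp (h j)).trace = _
    rw [hI, pauliOp_I, Matrix.trace_one]
    simp
  rw [htrace, h2] at h1
  simpa using h1.symm

lemma mem_hamSupp {N : ℕ} {J : Type*} [Fintype J] {lam : J → ℝ} {h : J → PauliString N} {j : J}
    (hj : lam j ≠ 0) {q : Fin N} (hq : h j q ≠ Pauli.I) : q ∈ hamSupp lam h := by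
  simp only [hamSupp, PauliString.supp, Finset.mem_biUnion, Finset.mem_filter, Finset.mem_univ,
    true_and]
  exact ⟨j, hj, hq⟩

namespace Circuit

variable {N M : ℕ} {Θ : Type*} {𝒰 : Circuit N M Θ} {J : Type*} [Fintype J] {lam : J → ℝ}
  {h : J → PauliString N}

lemma cost_hamiltonian (θ : Θ) :
    𝒰.cost (hamiltonian lam h) θ = ∑ j, lam j * 𝒰.cost (h j).toOp θ :=
  𝒰.cost_sum_smul lam _ θ

variable [MeasurableSpace Θ] {μ : Measure Θ} [IsProbabilityMeasure μ]

namespace IndependentTwoDesigns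

lemma integral_cost_hamiltonian (h𝒰 : 𝒰.IndependentTwoDesigns μ) (hinj : Function.Injective h)
    (htrace : (hamiltonian lam h).trace = 0) (hsupp : hamSupp lam h ⊆ 𝒰.totalSupp) :
    ∫ θ, 𝒰.cost (hamiltonian lam h) θ ∂μ = 0 := by
  -- The mean of a Pauli string is its correlation with the identity string.
  have hI : ∀ P : PauliString N, (fun θ => 𝒰.cost P.toOp θ)
      = fun θ => 𝒰.cost P.toOp θ * 𝒰.cost (PauliString.toOp fun _ => Pauli.I) θ := fun P => by
    simp only [cost_toOp_I, mul_one]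
  have hint : ∀ P : PauliString N, Integrable (fun θ => 𝒰.cost P.toOp θ) μ := fun P => by
    rw [hI]
    exact 𝒰.integrable_cost_mul_cost μ h𝒰.measurable _ _
  simp only [cost_hamiltonian]
  rw [integral_finsetSum _ fun j _ => (hint (h j)).const_mul (lam j)]
  refine Finset.sum_eq_zero fun j _ => ?_
  rw [integral_const_mul]
  by_cases hj : lam j = 0
  · rw [hj, zero_mul]
  · obtain ⟨q, hq⟩ := Function.ne_iff.mp (ne_I_of_trace_hamiltonian_eq_zero hinj htrace hj)
    rw [hI, h𝒰.integral_cost_mul_cost_eq_zero _ _ (hsupp (mem_hamSupp hj hq)) hq, mul_zero]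

lemma integral_cost_hamiltonian_sq (h𝒰 : 𝒰.IndependentTwoDesigns μ) (hinj : Function.Injective h)
    (hsupp : hamSupp lam h ⊆ 𝒰.totalSupp) :
    ∫ θ, 𝒰.cost (hamiltonian lam h) θ ^ 2 ∂μ
      = ∑ j, lam j ^ 2 * ∫ θ, 𝒰.cost (h j).toOp θ * 𝒰.cost (h j).toOp θ ∂μ := by
  have hint : ∀ i j, Integrable (fun θ =>
      (lam i * lam j) * (𝒰.cost (h i).toOp θ * 𝒰.cost (h j).toOp θ)) μ := fun i j =>
    (𝒰.integrable_cost_mul_cost μ h𝒰.measurable _ _).const_mul _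
  have hexp : ∀ θ, 𝒰.cost (hamiltonian lam h) θ ^ 2
      = ∑ i, ∑ j, (lam i * lam j) * (𝒰.cost (h i).toOp θ * 𝒰.cost (h j).toOp θ) := by
    intro θ
    rw [cost_hamiltonian, sq, Finset.sum_mul_sum]
    exact Finset.sum_congr rfl fun i _ => Finset.sum_congr rfl fun j _ => by ring
  simp only [hexp]
  rw [integral_finsetSum _ fun i _ => integrable_finsetSum _ fun j _ => hint i j]
  refine Finset.sum_congr rfl fun i _ => ?_
  rw [integral_finsetSum _ fun j _ => hint i j, Finset.sum_eq_single i]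
  · rw [integral_const_mul, sq]
  · intro j _ hji
    rw [integral_const_mul]
    by_cases hi : lam i = 0
    · rw [hi, zero_mul, zero_mul]
    by_cases hj : lam j = 0
    · rw [hj, mul_zero, zero_mul]
    obtain ⟨q, hq⟩ := Function.ne_iff.mp (hinj.ne hji)
    have hmem : q ∈ hamSupp lam h := by
      by_cases hjq : h j q = Pauli.I
      · exact mem_hamSupp hi fun hiq => hq (hjq.trans hiq.symm)
      · exact mem_hamSupp hj hjq
    rw [h𝒰.integral_cost_mul_cost_eq_zero _ _ (hsupp hmem) hq.symm, mul_zero]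
  · simp

lemma variance_cost_hamiltonian (h𝒰 : 𝒰.IndependentTwoDesigns μ) (hinj : Function.Injective h)
    (htrace : (hamiltonian lam h).trace = 0) (hsupp : hamSupp lam h ⊆ 𝒰.totalSupp) :
    variance (𝒰.cost (hamiltonian lam h)) μ
      = ∑ j, lam j ^ 2 * ∫ θ, 𝒰.cost (h j).toOp θ * 𝒰.cost (h j).toOp θ ∂μ := by
  have hm : Measurable (𝒰.cost (hamiltonian lam h)) := by
    rw [funext (cost_hamiltonian (𝒰 := 𝒰))]
    exact Finset.measurable_fun_sum _ fun j _ =>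
      (𝒰.measurable_cost_toOp h𝒰.measurable (h j)).const_mul _
  rw [variance_of_integral_eq_zero hm.aemeasurable
    (h𝒰.integral_cost_hamiltonian hinj htrace hsupp)]
  exact h𝒰.integral_cost_hamiltonian_sq hinj hsupp

lemma le_integral_cost_mul_self_of_ne_zero (h𝒰 : 𝒰.IndependentTwoDesigns μ)
    (hsupp : hamSupp lam h ⊆ 𝒰.totalSupp) {j : J} (hj : lam j ≠ 0) :
    (4 : ℝ) ^ (-((locality lam h * 𝒰.maxLocalDepth * 𝒰.maxBlockSize : ℕ) : ℤ))
      ≤ ∫ θ, 𝒰.cost (h j).toOp θ * 𝒰.cost (h j).toOp θ ∂μ := by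
  have hb : ∀ k, (𝒰.supp k).card ≤ 𝒰.maxBlockSize := fun k =>
    Finset.le_sup (f := fun k => (𝒰.supp k).card) (Finset.mem_univ k)
  have hloc : (h j).supp.card ≤ locality lam h :=
    Finset.le_sup (f := fun j => (h j).supp.card)
      (Finset.mem_filter.mpr ⟨Finset.mem_univ j, hj⟩)
  have hsum : ∑ q ∈ (h j).supp, 𝒰.localDepth q ≤ locality lam h * 𝒰.maxLocalDepth :=
    (Finset.sum_le_card_nsmul _ _ 𝒰.maxLocalDepth fun q _ =>
      Finset.le_sup (f := 𝒰.localDepth) (Finset.mem_univ q)).trans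
        (Nat.mul_le_mul_right _ hloc)
  refine le_trans ?_ (h𝒰.le_integral_cost_mul_self hb (h j) fun q hq => Or.inl ?_)
  · rw [zpow_neg, zpow_natCast, mul_comm _ 𝒰.maxBlockSize, pow_mul, ← inv_pow]
    exact pow_le_pow_of_le_one (by positivity) (inv_le_one_of_one_le₀ (one_le_pow₀ (by norm_num)))
      hsum
  · by_contra hne
    exact hq (hsupp (mem_hamSupp hj hne))

end IndependentTwoDesigns

end Circuit

end PQC

end

theorem theorem1 {N M : ℕ} {Θ : Type*} [MeasurableSpace Θ]
    (μ : MeasureTheory.Measure Θ) [MeasureTheory.IsProbabilityMeasure μ]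
    (𝒰 : PQC.Circuit N M Θ) (h𝒰 : 𝒰.IndependentTwoDesigns μ)
    {J : Type*} [Fintype J] (lam : J → ℝ) (h : J → PQC.PauliString N)
    (hinj : Function.Injective h)
    (htrace : (PQC.hamiltonian lam h).trace = 0)
    (hsupp : PQC.hamSupp lam h ⊆ 𝒰.totalSupp) :
    𝒰.fluctuation μ lam h ≥
        (2 : ℝ) ^ (-((PQC.locality lam h * 𝒰.maxLocalDepth * 𝒰.maxBlockSize : ℕ) : ℤ)) *
          (PQC.coeffNorm₂ lam / PQC.coeffNorm₁ lam) ∧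
      ProbabilityTheory.variance (𝒰.cost (PQC.hamiltonian lam h)) μ ≥
        (4 : ℝ) ^ (-((PQC.locality lam h * 𝒰.maxLocalDepth * 𝒰.maxBlockSize : ℕ) : ℤ)) *
          PQC.coeffNorm₂ lam ^ 2 := by
  have hvar : ProbabilityTheory.variance (𝒰.cost (PQC.hamiltonian lam h)) μ ≥
      (4 : ℝ) ^ (-((PQC.locality lam h * 𝒰.maxLocalDepth * 𝒰.maxBlockSize : ℕ) : ℤ)) *
        PQC.coeffNorm₂ lam ^ 2 := by
    rw [h𝒰.variance_cost_hamiltonian hinj htrace hsupp, PQC.coeffNorm₂,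
      Real.sq_sqrt (Finset.sum_nonneg fun j _ => sq_nonneg _), Finset.mul_sum]
    refine Finset.sum_le_sum fun j _ => ?_
    by_cases hj : lam j = 0
    · simp [hj]
    · rw [mul_comm]
      exact mul_le_mul_of_nonneg_left (h𝒰.le_integral_cost_mul_self_of_ne_zero hsupp hj)
        (sq_nonneg _)
  refine ⟨?_, hvar⟩
  rw [PQC.Circuit.fluctuation, ge_iff_le, ← mul_div_assoc]
  refine div_le_div_of_nonneg_right ?_ (Finset.sum_nonneg fun j _ => abs_nonneg (lam j))
  refine Real.le_sqrt_of_sq_le ?_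
  rwa [mul_pow, ← zpow_natCast, ← zpow_mul, mul_comm _ ((2 : ℕ) : ℤ), zpow_mul,
    show ((2 : ℝ) ^ ((2 : ℕ) : ℤ)) = 4 by norm_num]
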